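/- Let $m\ge 1$, let $0<b_0<b_1<\cdots<b_m$ be integers and let $e_0,e_1,\dots,e_m$ be positive integers. Assume that there exist a prime $p$ and a positive integer $t$ such that $p^t\mid b_0$ but $p^t\nmid b_i$ for $1\le i\le m$. Then, for every polynomial $P(x)\in\mathbb Z[x]$ with $P(0)=1$ and $P(1)\ne 0$, the equation $$f(x^{b_0})^{e_0}f(x^{b_1})^{e_1}\cdots f(x^{b_m})^{e_m}=\frac{P(x)}{1-x}$$ has no solution $f(x)$ in the ring $\mathbb C[[x]]$ of formal power series. -/

import Mathlib

/-!
Taking logarithmic derivatives makes the equation linear: if `a n` are the coefficients of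
`X f' / f`, then `∑_{b i ∣ n} e i * b i * a (n / b i) = 1 - ∑_ρ ρ⁻ⁿ`, the last sum being over the
roots `ρ` of `P` (`exists_logDeriv_coeff`). The left-hand side is a Dirichlet convolution with a
finitely supported function.

Only the roots of `P` that are roots of unity of an order composed of the primes dividing
`L = ∏ b i` matter: the other roots are removed by averaging over `n ↦ n (1 + N j)`, where `N` is a
large power of `L` (`exists_averaged_solution`). As `P` has integer coefficients, the remaining
power sum is `∑_{g ∣ N} k g * g * [g ∣ n]` with integers `k g`, whose sum is the multiplicity of the
root `1`, that is, `0` (`IsRootSum.roots`). A Möbius inversion and a division by `n` then lead to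
a function `u` with `∑_{b i ∣ n} e i * u (n / b i) = z n`, where `z n = [n = 1] - [n ∣ N] * k n`
is integer-valued, has finite support, and has total sum `1` (`exists_moebius_transform`).

Now `b 0` is both the smallest of the `b i` and the only one with maximal `p`-adic valuation. This
forces `u` to have finite support as well (`finite_support_of_linear_eq`). Mapping `n` to
`X ^ v_p(n)` gives a factorization `Z = B * U` of polynomials with `B = ∑ e i * X ^ v_p(b i)` and
`Z ∈ ℤ[X]`, `Z(1) = 1` (`exists_polynomial_factorization`). By the Gauss lemma the primitive part of
`B` divides `Z` over `ℤ`, so its value at `1` divides `1`; but `B` has at least two terms, with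
positive coefficients, so that this value is at least `2` (`not_dvd_of_eval_one_eq_one`).
-/

/-! ### Logarithmic derivatives of formal power series -/

/-- `G` is the logarithmic derivative `X F' / F` of the power series `F`, written without
division. -/
def HasLogDeriv (F G : PowerSeries ℂ) : Prop :=
  PowerSeries.X * PowerSeries.derivative ℂ F = G * F

namespace HasLogDeriv

open PowerSeries

theorem one : HasLogDeriv 1 0 := by simp [HasLogDeriv]

theorem mul {F G A B : PowerSeries ℂ} (hF : HasLogDeriv F A) (hG : HasLogDeriv G B) :
    HasLogDeriv (F * G) (A + B) := by
  unfold HasLogDeriv at *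
  simp only [Derivation.leibniz, smul_eq_mul]
  linear_combination G * hF + F * hG

theorem pow {F A : PowerSeries ℂ} (hF : HasLogDeriv F A) (n : ℕ) :
    HasLogDeriv (F ^ n) (n * A) := by
  induction n with
  | zero => simpa using one
  | succ n ih =>
    rw [pow_succ]
    convert ih.mul hF using 1
    push_cast
    ring

theorem prod {ι : Type*} (s : Finset ι) {F A : ι → PowerSeries ℂ}
    (h : ∀ i ∈ s, HasLogDeriv (F i) (A i)) :
    HasLogDeriv (∏ i ∈ s, F i) (∑ i ∈ s, A i) := by
  classical
  induction s using Finset.induction_on with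
  | empty => simpa using one
  | insert i s hi ih =>
    rw [Finset.prod_insert hi, Finset.sum_insert hi]
    exact (h i (Finset.mem_insert_self i s)).mul
      (ih fun j hj => h j (Finset.mem_insert_of_mem hj))

theorem multiset_prod {ι : Type*} (s : Multiset ι) {F A : ι → PowerSeries ℂ}
    (h : ∀ i ∈ s, HasLogDeriv (F i) (A i)) :
    HasLogDeriv (s.map F).prod (s.map A).sum := by
  induction s using Multiset.induction_on with
  | empty => simpa using one
  | cons i s ih =>
    simp only [Multiset.map_cons, Multiset.prod_cons, Multiset.sum_cons]
    exact (h i (Multiset.mem_cons_self i s)).mul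
      (ih fun j hj => h j (Multiset.mem_cons_of_mem hj))

theorem unique {F A B : PowerSeries ℂ} (hF : F ≠ 0) (hA : HasLogDeriv F A)
    (hB : HasLogDeriv F B) : A = B :=
  mul_right_cancel₀ hF (hA.symm.trans hB)

theorem of_constantCoeff_ne_zero {F : PowerSeries ℂ} (hF : constantCoeff F ≠ 0) :
    HasLogDeriv F (X * derivative ℂ F * F⁻¹) := by
  rw [HasLogDeriv, mul_assoc _ F⁻¹, PowerSeries.inv_mul_cancel _ hF, mul_one]

theorem coeff_X_mul_derivative (F : PowerSeries ℂ) (n : ℕ) :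
    coeff n (X * derivative ℂ F) = n * coeff n F := by
  cases n with
  | zero => simp
  | succ n =>
    rw [mul_comm X, coeff_succ_mul_X, PowerSeries.coeff_derivative]
    push_cast
    ring

theorem expand {F A : PowerSeries ℂ} (hF : HasLogDeriv F A) {b : ℕ} (hb : b ≠ 0) :
    HasLogDeriv (PowerSeries.expand b hb F) (b * PowerSeries.expand b hb A) := by
  have key : X * derivative ℂ (PowerSeries.expand b hb F) =
      (b : PowerSeries ℂ) * PowerSeries.expand b hb (X * derivative ℂ F) := by
    ext n
    rw [coeff_X_mul_derivative, ← nsmul_eq_mul b, map_nsmul, coeff_expand, coeff_expand]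
    split_ifs with h
    · obtain ⟨k, rfl⟩ := h
      rw [Nat.mul_div_cancel_left _ (Nat.pos_of_ne_zero hb), coeff_X_mul_derivative]
      push_cast
      rw [nsmul_eq_mul]
      ring
    · simp
  rw [HasLogDeriv, key, show X * derivative ℂ F = A * F from hF, map_mul, mul_assoc]

theorem one_sub_smul_X (c : ℂ) :
    HasLogDeriv (1 - C c * X) (-(C c * X * PowerSeries.mk fun n => c ^ n)) := by
  have h : (PowerSeries.mk fun n => c ^ n) * (1 - C c * X) = 1 := by
    ext n
    cases n with
    | zero => simp
    | succ n =>
      rw [mul_sub, mul_one, ← mul_assoc, map_sub, coeff_succ_mul_X, mul_comm, coeff_C_mul]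
      simp [pow_succ']
  rw [HasLogDeriv, neg_mul, mul_assoc _ (PowerSeries.mk _), h]
  simp [mul_comm]

end HasLogDeriv

/-- A complex polynomial with constant term `1` is the product of the factors `1 - ρ⁻¹ X` over
its roots `ρ`. -/
theorem Polynomial.eq_prod_one_sub_inv_root (P : Polynomial ℂ) (hP : P.eval 0 = 1) :
    P = (P.roots.map fun ρ => 1 - Polynomial.C ρ⁻¹ * Polynomial.X).prod := by
  have h0 : ∀ ρ ∈ P.roots, ρ ≠ 0 := by
    rintro ρ hρ rfl
    have := (Polynomial.mem_roots'.1 hρ).2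
    rw [Polynomial.IsRoot.def, hP] at this
    exact one_ne_zero this
  have h1 := (IsAlgClosed.splits P).eq_prod_roots
  have h2 : (P.roots.map fun ρ => Polynomial.X - Polynomial.C ρ) =
      P.roots.map fun ρ => Polynomial.C (-ρ) * (1 - Polynomial.C ρ⁻¹ * Polynomial.X) := by
    refine Multiset.map_congr rfl fun ρ hρ => ?_
    rw [mul_sub, ← mul_assoc, ← Polynomial.C_mul, neg_mul, mul_inv_cancel₀ (h0 ρ hρ)]
    simp
    ring
  rw [h2, Multiset.prod_map_mul] at h1
  have h3 := congrArg (Polynomial.eval 0) h1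
  simp only [hP, Polynomial.eval_mul, Polynomial.eval_C, Polynomial.eval_multiset_prod,
    Multiset.map_map, Function.comp_def, Polynomial.eval_sub, Polynomial.eval_one,
    Polynomial.eval_X, mul_zero, sub_zero, Multiset.map_const', Multiset.prod_replicate,
    one_pow, mul_one] at h3
  rw [← mul_assoc] at h1
  have h4 : (P.roots.map fun ρ => Polynomial.C (-ρ)).prod =
      Polynomial.C (P.roots.map fun ρ => -ρ).prod := by
    rw [map_multiset_prod, Multiset.map_map]
    rfl
  rw [h4, ← Polynomial.C_mul, ← h3, Polynomial.C_1, one_mul] at h1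
  exact h1

/-- The equation for `f` in terms of the coefficients `a n` of `X f' / f`: it becomes linear, and
its right-hand side is one minus a power sum of the inverse roots of `P`. -/
theorem exists_logDeriv_coeff {ι : Type*} [Fintype ι] (b e : ι → ℕ) (hb : ∀ i, b i ≠ 0)
    (he : ∃ i, e i ≠ 0) (P : Polynomial ℂ) (hP : P.eval 0 = 1) (f : PowerSeries ℂ)
    (hf : ∏ i, (PowerSeries.expand (b i) (hb i) f) ^ e i =
      (P : PowerSeries ℂ) * (1 - PowerSeries.X : PowerSeries ℂ)⁻¹) :
    ∃ a : ℕ → ℂ, ∀ n, n ≠ 0 →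
      (∑ i, if b i ∣ n then (e i * b i : ℂ) * a (n / b i) else 0) =
        1 - (P.roots.map fun ρ => ρ⁻¹ ^ n).sum := by
  have hX : PowerSeries.constantCoeff (1 - PowerSeries.X : PowerSeries ℂ) ≠ 0 := by simp
  have hf0 : PowerSeries.constantCoeff f ≠ 0 := by
    obtain ⟨i, hi⟩ := he
    intro h0
    have := congrArg PowerSeries.constantCoeff hf
    simp only [map_prod, map_pow, map_mul, PowerSeries.constantCoeff_expand, h0,
      Polynomial.constantCoeff_coe, Polynomial.coeff_zero_eq_eval_zero, hP] at this
    rw [Finset.prod_eq_zero (Finset.mem_univ i) (zero_pow hi)] at this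
    simp at this
  set A := PowerSeries.X * PowerSeries.derivative ℂ f * f⁻¹
  have hfA : HasLogDeriv f A := .of_constantCoeff_ne_zero hf0
  have hL := HasLogDeriv.prod Finset.univ fun i _ => (hfA.expand (hb i)).pow (e i)
  have hL' := hL.mul (HasLogDeriv.one_sub_smul_X 1)
  have hR := HasLogDeriv.multiset_prod P.roots fun ρ _ => HasLogDeriv.one_sub_smul_X ρ⁻¹
  have hRP : (P.roots.map fun ρ => (1 - PowerSeries.C ρ⁻¹ * PowerSeries.X)).prod
      = (P : PowerSeries ℂ) := by
    conv_rhs => rw [P.eq_prod_one_sub_inv_root hP, ← Polynomial.coeToPowerSeries.ringHom_apply,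
      map_multiset_prod, Multiset.map_map]
    refine congrArg Multiset.prod (Multiset.map_congr rfl fun ρ _ => ?_)
    simp [Polynomial.coeToPowerSeries.ringHom_apply]
  rw [hRP] at hR
  rw [hf, map_one, one_mul, mul_assoc, PowerSeries.inv_mul_cancel _ hX, mul_one] at hL'
  have hP0 : (P : PowerSeries ℂ) ≠ 0 := by
    intro h
    have := congrArg PowerSeries.constantCoeff h
    simp [Polynomial.coeff_zero_eq_eval_zero, hP] at this
  have hmain := HasLogDeriv.unique hP0 hL' hR
  refine ⟨fun n => PowerSeries.coeff n A, fun n hn => ?_⟩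
  obtain ⟨n, rfl⟩ := Nat.exists_eq_succ_of_ne_zero hn
  have hc := congrArg (PowerSeries.coeff (n + 1)) hmain
  have hcoef : ∀ c : ℂ, PowerSeries.coeff (n + 1)
      (-(PowerSeries.C c * PowerSeries.X * PowerSeries.mk fun n => c ^ n)) = - c ^ (n + 1) := by
    intro c
    rw [map_neg, mul_assoc, PowerSeries.coeff_C_mul, mul_comm PowerSeries.X,
      PowerSeries.coeff_succ_mul_X, PowerSeries.coeff_mk, pow_succ']
  have h1 := hcoef 1
  rw [map_one, one_mul] at h1
  rw [map_add, h1, map_sum, map_multiset_sum, Multiset.map_map] at hc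
  simp only [Function.comp_def, hcoef, one_pow, Multiset.sum_map_neg] at hc
  have hs : ∀ i, PowerSeries.coeff (n + 1)
      ((e i : PowerSeries ℂ) * ((b i : PowerSeries ℂ) * PowerSeries.expand (b i) (hb i) A)) =
      if b i ∣ n + 1 then (e i * b i : ℂ) * PowerSeries.coeff ((n + 1) / b i) A else 0 := by
    intro i
    rw [← nsmul_eq_mul, ← nsmul_eq_mul, map_nsmul, map_nsmul, PowerSeries.coeff_expand]
    split_ifs
    · simp only [nsmul_eq_mul, mul_assoc]
    · simp
  simp only [hs] at hc
  linear_combination hc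

/-! ### Extracting the constant part of an exponential sum -/

/-- Distinct geometric progressions are linearly independent, so there is a linear functional on
all sequences which singles out the progression with ratio `1`. -/
theorem exists_functional_geometric :
    ∃ Λ : (ℕ → ℂ) →ₗ[ℂ] ℂ, ∀ β : ℂ, Λ (fun j => β ^ j) = if β = 1 then 1 else 0 := by
  have li : LinearIndependent ℂ fun (β : ℂ) (j : ℕ) => β ^ j := by
    have h := (linearIndependent_monoidHom (Multiplicative ℕ) ℂ).comp (powersHom ℂ)
      (powersHom ℂ).injective
    exact h
  obtain ⟨Λ, hΛ⟩ := LinearMap.exists_extend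
    ((Finsupp.lapply (1 : ℂ) : (ℂ →₀ ℂ) →ₗ[ℂ] ℂ) ∘ₗ li.repr)
  refine ⟨Λ, fun β => ?_⟩
  have h := LinearMap.congr_fun hΛ ⟨fun j => β ^ j, Submodule.subset_span ⟨β, rfl⟩⟩
  simp only [LinearMap.comp_apply, Submodule.subtype_apply] at h
  rw [h]
  have := li.repr_eq_single β ⟨fun j => β ^ j, Submodule.subset_span ⟨β, rfl⟩⟩ rfl
  simp [this, Finsupp.single_apply]

/-! ### Power sums of roots of unity among the roots of an integer polynomial -/

open Polynomial in
/-- The power sum of exponent `-n` over all `d`-th roots of unity. -/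
theorem sum_inv_pow_nthRoots {d : ℕ} (hd : d ≠ 0) (n : ℕ) :
    ∑ ζ ∈ nthRootsFinset d (1 : ℂ), ζ⁻¹ ^ n = if d ∣ n then (d : ℂ) else 0 := by
  have hω := Complex.isPrimitiveRoot_exp d hd
  set ω := Complex.exp (2 * Real.pi * Complex.I / d)
  have hpos : 0 < d := Nat.pos_of_ne_zero hd
  by_cases h : d ∣ n
  · obtain ⟨k, rfl⟩ := h
    rw [if_pos (dvd_mul_right d k), Finset.sum_congr rfl (g := fun _ => (1 : ℂ)), Finset.sum_const,
      hω.card_nthRootsFinset]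
    · simp
    · intro ζ hζ
      rw [mem_nthRootsFinset hpos] at hζ
      rw [inv_pow, pow_mul, hζ, one_pow, inv_one]
  · rw [if_neg h]
    -- multiplication by `ω` permutes the roots of unity and scales the sum by `ω⁻¹ ^ n ≠ 1`
    have hne : ω⁻¹ ^ n ≠ 1 := by
      intro h1
      exact h ((hω.pow_eq_one_iff_dvd n).1 (by rwa [inv_pow, inv_eq_one] at h1))
    have hω0 : ω ≠ 0 := hω.ne_zero hd
    have hperm : ∑ ζ ∈ nthRootsFinset d (1 : ℂ), (ω * ζ)⁻¹ ^ n =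
        ∑ ζ ∈ nthRootsFinset d (1 : ℂ), ζ⁻¹ ^ n := by
      refine Finset.sum_bij' (fun ζ _ => ω * ζ) (fun ζ _ => ω⁻¹ * ζ) ?_ ?_ ?_ ?_ ?_
      · intro ζ hζ
        rw [mem_nthRootsFinset hpos] at hζ ⊢
        rw [mul_pow, hζ, hω.pow_eq_one, one_mul]
      · intro ζ hζ
        rw [mem_nthRootsFinset hpos] at hζ ⊢
        rw [mul_pow, hζ, inv_pow, hω.pow_eq_one, inv_one, one_mul]
      · intro ζ _
        exact inv_mul_cancel_left₀ hω0 ζ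
      · intro ζ _
        exact mul_inv_cancel_left₀ hω0 ζ
      · intro ζ _
        rfl
    simp only [mul_inv, mul_pow, ← Finset.mul_sum] at hperm
    by_contra h0
    exact hne (mul_right_cancel₀ h0 (hperm.trans (one_mul _).symm))

/-- `F` is an integer combination of the power sums `n ↦ g · [g ∣ n]` of the `g`-th roots of unity,
`g ∣ N`, with coefficients adding up to `c`. -/
def IsRootSum (N : ℕ) (F : ℕ → ℂ) (c : ℤ) : Prop :=
  ∃ k : ℕ → ℤ, (∀ n, F n = ∑ g ∈ N.divisors, (k g : ℂ) * if g ∣ n then (g : ℂ) else 0) ∧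
    ∑ g ∈ N.divisors, k g = c

namespace IsRootSum

theorem zero (N : ℕ) : IsRootSum N (fun _ => 0) 0 := ⟨fun _ => 0, by simp, by simp⟩

theorem add {N : ℕ} {F G : ℕ → ℂ} {c d : ℤ} (hF : IsRootSum N F c) (hG : IsRootSum N G d) :
    IsRootSum N (fun n => F n + G n) (c + d) := by
  obtain ⟨k, hk, rfl⟩ := hF
  obtain ⟨l, hl, rfl⟩ := hG
  refine ⟨fun g => k g + l g, fun n => ?_, Finset.sum_add_distrib⟩
  simp only [hk, hl, Int.cast_add, add_mul, Finset.sum_add_distrib]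

theorem neg {N : ℕ} {F : ℕ → ℂ} {c : ℤ} (hF : IsRootSum N F c) :
    IsRootSum N (fun n => -F n) (-c) := by
  obtain ⟨k, hk, rfl⟩ := hF
  refine ⟨fun g => -k g, fun n => ?_, by simp⟩
  simp only [hk, Int.cast_neg, neg_mul, Finset.sum_neg_distrib]

theorem sum {ι : Type*} (s : Finset ι) {N : ℕ} {F : ι → ℕ → ℂ} {c : ι → ℤ}
    (h : ∀ i ∈ s, IsRootSum N (F i) (c i)) :
    IsRootSum N (fun n => ∑ i ∈ s, F i n) (∑ i ∈ s, c i) := by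
  classical
  induction s using Finset.induction_on with
  | empty => simpa using zero N
  | insert i s hi ih =>
    simp only [Finset.sum_insert hi]
    exact (h i (Finset.mem_insert_self i s)).add
      (ih fun j hj => h j (Finset.mem_insert_of_mem hj))

theorem nthRoots {N d : ℕ} (hN : N ≠ 0) (hd : d ∣ N) :
    IsRootSum N (fun n => ∑ ζ ∈ Polynomial.nthRootsFinset d (1 : ℂ), ζ⁻¹ ^ n) 1 := by
  have hmem : d ∈ N.divisors := Nat.mem_divisors.2 ⟨hd, hN⟩
  refine ⟨fun g => if g = d then 1 else 0, fun n => ?_, by simp [hd, hN]⟩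
  simp only []
  rw [sum_inv_pow_nthRoots (ne_zero_of_dvd_ne_zero hN hd), Finset.sum_eq_single_of_mem d hmem]
  · simp
  · intro g _ hg
    simp [hg]

/-- The cyclotomic case, by Möbius inversion in the form of a strong induction on the order. -/
theorem primitiveRoots {N : ℕ} (hN : N ≠ 0) (d : ℕ) (hd : d ∣ N) :
    IsRootSum N (fun n => ∑ ζ ∈ primitiveRoots d ℂ, ζ⁻¹ ^ n) (if d = 1 then 1 else 0) := by
  classical
  induction d using Nat.strong_induction_on with
  | _ d ih =>
    have hd0 : d ≠ 0 := ne_zero_of_dvd_ne_zero hN hd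
    have : NeZero d := ⟨hd0⟩
    have hP : IsRootSum N (fun n => ∑ g ∈ d.properDivisors, ∑ ζ ∈ _root_.primitiveRoots g ℂ, ζ⁻¹ ^ n)
        (∑ g ∈ d.properDivisors, if g = 1 then 1 else 0) :=
      sum _ fun g hg => ih g (Nat.mem_properDivisors.1 hg).2
        ((Nat.mem_properDivisors.1 hg).1.trans hd)
    convert (nthRoots hN hd).add hP.neg using 1
    · funext n
      rw [IsPrimitiveRoot.nthRoots_one_eq_biUnion_primitiveRoots,
        Finset.sum_biUnion, ← Nat.cons_self_properDivisors hd0, Finset.sum_cons]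
      · ring
      · intro i _ j _ hij
        exact IsPrimitiveRoot.disjoint hij
    · simp only [Finset.sum_ite_eq', Nat.mem_properDivisors, one_dvd, true_and]
      split_ifs <;> first | rfl | omega

open Polynomial in
/-- By irreducibility of the cyclotomic polynomials, the `N`-th roots of unity among the roots of an
integer polynomial come in full sets of primitive roots of the various orders dividing `N`. -/
theorem roots {N : ℕ} (hN : N ≠ 0) (P : ℤ[X]) (hP : P ≠ 0) :
    IsRootSum N
      (fun n => (((P.map (Int.castRingHom ℂ)).roots.filter fun ρ => ρ ^ N = 1).map
        fun ρ => ρ⁻¹ ^ n).sum)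
      ((P.map (Int.castRingHom ℂ)).rootMultiplicity 1) := by
  classical
  have hinj : Function.Injective (Int.castRingHom ℂ) := RingHom.injective_int _
  induction hk : P.natDegree using Nat.strong_induction_on generalizing P with
  | _ D ih =>
    by_cases hα : ∃ α ∈ (P.map (Int.castRingHom ℂ)).roots, α ^ N = 1
    · obtain ⟨α, hα, hαN⟩ := hα
      have hprim := IsPrimitiveRoot.orderOf α
      have hdN : orderOf α ∣ N := orderOf_dvd_of_pow_eq_one hαN
      set d := orderOf α
      have hd0 : d ≠ 0 := ne_zero_of_dvd_ne_zero hN hdN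
      have hdpos : 0 < d := Nat.pos_of_ne_zero hd0
      have hroot : aeval α P = 0 := by
        have := (mem_roots'.1 hα).2
        rwa [IsRoot.def, eval_map, ← algebraMap_int_eq, ← aeval_def] at this
      obtain ⟨Q, rfl⟩ : cyclotomic d ℤ ∣ P := by
        rw [cyclotomic_eq_minpoly hprim hdpos]
        exact minpoly.isIntegrallyClosed_dvd (hprim.isIntegral hdpos) hroot
      have hQ : Q ≠ 0 := right_ne_zero_of_mul hP
      have hdeg : Q.natDegree < D := by
        rw [← hk, natDegree_mul (cyclotomic_ne_zero d ℤ) hQ, natDegree_cyclotomic]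
        have := Nat.totient_pos.2 hdpos
        omega
      have hne : cyclotomic d ℂ * Q.map (Int.castRingHom ℂ) ≠ 0 :=
        mul_ne_zero (cyclotomic_ne_zero d ℂ) ((Polynomial.map_ne_zero_iff hinj).2 hQ)
      have : NeZero (d : ℂ) := ⟨Nat.cast_ne_zero.2 hd0⟩
      convert (primitiveRoots hN d hdN).add (ih _ hdeg Q hQ rfl) using 1
      · funext n
        rw [Polynomial.map_mul, map_cyclotomic, roots_mul hne, Multiset.filter_add,
          Multiset.map_add, Multiset.sum_add, cyclotomic.roots_eq_primitiveRoots_val,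
          Multiset.filter_eq_self.2]
        · rfl
        · intro ζ hζ
          have hζ' := (mem_primitiveRoots hdpos).1 hζ
          exact (hζ'.pow_eq_one_iff_dvd N).2 hdN
      · rw [Polynomial.map_mul, map_cyclotomic, rootMultiplicity_mul hne]
        push_cast
        congr 1
        rw [← count_roots, cyclotomic.roots_eq_primitiveRoots_val,
          Multiset.count_eq_of_nodup (_root_.primitiveRoots d ℂ).nodup]
        simp only [Finset.mem_val, mem_primitiveRoots hdpos, IsPrimitiveRoot.one_left_iff]
        split_ifs <;> rfl
    · push Not at hα
      convert zero N using 1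
      · funext n
        rw [Multiset.filter_eq_nil.2 hα]
        simp
      · rw [Int.natCast_eq_zero]
        by_contra h
        refine hα 1 ?_ (one_pow N)
        rw [← Multiset.count_ne_zero, count_roots]
        exact h

end IsRootSum

/-! ### Möbius inversion of the linear equation -/

open ArithmeticFunction ArithmeticFunction.zeta ArithmeticFunction.Moebius in
/-- If a function `a` satisfies the linear equation at all `n` composed of the primes
dividing `L`, then so does its Möbius transform `μ * a`, restricted to these `n`; and there the
right-hand side is supported on the divisors of `N`. Dividing the transform by `n` removes the
weights `b i`. -/
theorem exists_moebius_transform {ι : Type*} [Fintype ι] (b e : ι → ℕ) {L N h : ℕ} (hL : L ≠ 0)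
    (hb : ∀ i, b i ∣ L) (hN : N ∣ L ^ h) (k : ℕ → ℤ) (a : ℕ → ℂ)
    (ha : ∀ n, (∃ j, n ∣ L ^ j) → (∑ i, if b i ∣ n then (e i * b i : ℂ) * a (n / b i) else 0) =
      1 - ∑ g ∈ N.divisors, (k g : ℂ) * if g ∣ n then (g : ℂ) else 0) :
    ∃ u : ℕ → ℂ, ∀ n, n ≠ 0 → (∑ i, if b i ∣ n then (e i : ℂ) * u (n / b i) else 0) =
      (((if n = 1 then 1 else 0) - if n ∣ N then k n else 0 : ℤ) : ℂ) := by
  classical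
  have hb0 : ∀ i, b i ≠ 0 := fun i => ne_zero_of_dvd_ne_zero hL (hb i)
  have hN0 : N ≠ 0 := ne_zero_of_dvd_ne_zero (pow_ne_zero h hL) hN
  let δ : ℕ → ArithmeticFunction ℂ := fun c => ⟨fun n => if n = 0 then 0 else if n = c then 1 else 0,
    if_pos rfl⟩
  have hδ : ∀ c, c ≠ 0 → ∀ (F : ArithmeticFunction ℂ) (n : ℕ),
      n ≠ 0 → (δ c * F) n = if c ∣ n then F (n / c) else 0 := by
    intro c hc F n hn
    rw [ArithmeticFunction.mul_apply, Nat.sum_divisorsAntidiagonal (fun x y => δ c x * F y)]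
    have : ∀ x ∈ n.divisors, δ c x * F (n / x) = if x = c then F (n / c) else 0 := by
      intro x hx
      have hx0 : x ≠ 0 := (Nat.pos_of_mem_divisors hx).ne'
      by_cases hxc : x = c <;> simp [δ, hxc, hc]
    rw [Finset.sum_congr rfl this, Finset.sum_ite_eq']
    simp [hn]
  let a' : ArithmeticFunction ℂ := ⟨fun n => if n = 0 then 0 else a n, if_pos rfl⟩
  let s : ArithmeticFunction ℂ :=
    ⟨fun n => if n = 0 then 0 else (if n = 1 then 1 else 0) - if n ∣ N then (n * k n : ℂ) else 0,
      if_pos rfl⟩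
  let T : ArithmeticFunction ℂ := ∑ i, (e i * b i : ℂ) • (δ (b i) * a')
  have hsum : ∀ (F : ι → ArithmeticFunction ℂ) (n : ℕ), (∑ i, F i) n = ∑ i, F i n := by
    intro F n
    induction (Finset.univ : Finset ι) using Finset.induction_on with
    | empty => simp
    | insert i s hi ih =>
      rw [Finset.sum_insert hi, Finset.sum_insert hi, ArithmeticFunction.add_apply, ih]
  have hT : ∀ n, (∃ j, n ∣ L ^ j) → T n = ((ζ : ArithmeticFunction ℂ) * s) n := by
    rintro n hn
    have hn0 : n ≠ 0 := by
      obtain ⟨j, hj⟩ := hn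
      exact ne_zero_of_dvd_ne_zero (pow_ne_zero j hL) hj
    rw [coe_zeta_mul_apply]
    have h1 : T n = ∑ i, if b i ∣ n then (e i * b i : ℂ) * a (n / b i) else 0 := by
      simp only [T, hsum, ArithmeticFunction.smul_map]
      refine Finset.sum_congr rfl fun i _ => ?_
      rw [hδ _ (hb0 i) _ _ hn0, smul_eq_mul]
      split_ifs with hd
      · have : n / b i ≠ 0 := (Nat.div_pos (Nat.le_of_dvd (Nat.pos_of_ne_zero hn0) hd)
          (Nat.pos_of_ne_zero (hb0 i))).ne'
        simp only [a', coe_mk, if_neg this]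
      · simp
    have h2 : ∀ d ∈ n.divisors,
        s d = (if d = 1 then 1 else 0) - if d ∣ N then (d * k d : ℂ) else 0 := by
      intro d hd
      simp [s, (Nat.pos_of_mem_divisors hd).ne']
    rw [h1, ha n hn, Finset.sum_congr rfl h2, Finset.sum_sub_distrib, Finset.sum_ite_eq',
      if_pos (Nat.one_mem_divisors.2 hn0)]
    congr 1
    have h3 : ∀ g : ℕ, ((k g : ℂ) * if g ∣ n then (g : ℂ) else 0) =
        if g ∣ n then (g * k g : ℂ) else 0 := by
      intro g
      split_ifs <;> ring
    simp only [h3]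
    rw [← Finset.sum_filter, ← Finset.sum_filter]
    refine Finset.sum_congr ?_ fun _ _ => rfl
    ext g
    simp only [Finset.mem_filter, Nat.mem_divisors]
    tauto
  have hμT : ∀ n, (∃ j, n ∣ L ^ j) → ((μ : ArithmeticFunction ℂ) * T) n = s n := by
    rintro n ⟨j, hj⟩
    have : ((μ : ArithmeticFunction ℂ) * T) n =
        ((μ : ArithmeticFunction ℂ) * ((ζ : ArithmeticFunction ℂ) * s)) n := by
      rw [ArithmeticFunction.mul_apply, ArithmeticFunction.mul_apply]
      refine Finset.sum_congr rfl fun x hx => ?_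
      rw [hT x.2 ⟨j, (Dvd.intro_left _ (Nat.mem_divisorsAntidiagonal.1 hx).1).trans hj⟩]
    rw [this, ← mul_assoc, coe_moebius_mul_coe_zeta, one_mul]
  have hμT' : (μ : ArithmeticFunction ℂ) * T =
      ∑ i, (e i * b i : ℂ) • (δ (b i) * ((μ : ArithmeticFunction ℂ) * a')) := by
    simp only [T, Finset.mul_sum]
    refine Finset.sum_congr rfl fun i _ => ?_
    rw [mul_smul_comm, mul_left_comm]
  refine ⟨fun n => if ∃ j, n ∣ L ^ j then ((μ : ArithmeticFunction ℂ) * a') n / n else 0,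
    fun n hn => ?_⟩
  beta_reduce
  have hnC : (n : ℂ) ≠ 0 := Nat.cast_ne_zero.2 hn
  by_cases hsm : ∃ j, n ∣ L ^ j
  · have h1 := hμT n hsm
    rw [hμT', hsum] at h1
    simp only [ArithmeticFunction.smul_map, smul_eq_mul, s, coe_mk, if_neg hn] at h1
    have h2 : (n : ℂ) * (((if n = 1 then 1 else 0) - if n ∣ N then k n else 0 : ℤ) : ℂ) =
        (if n = 1 then 1 else 0) - if n ∣ N then (n * k n : ℂ) else 0 := by
      push_cast
      by_cases h1n : n = 1
      · subst h1n
        simp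
      · simp [h1n]
    refine mul_left_cancel₀ hnC ?_
    rw [h2, ← h1, Finset.mul_sum]
    refine Finset.sum_congr rfl fun i _ => ?_
    rw [hδ _ (hb0 i) _ _ hn]
    by_cases hd : b i ∣ n
    · obtain ⟨c, rfl⟩ := hd
      obtain ⟨j, hj⟩ := hsm
      have hc : c ≠ 0 := right_ne_zero_of_mul hn
      rw [if_pos (dvd_mul_right _ _), if_pos (dvd_mul_right _ _),
        Nat.mul_div_cancel_left _ (Nat.pos_of_ne_zero (hb0 i)),
        if_pos ⟨j, (dvd_mul_left _ _).trans hj⟩]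
      have : (c : ℂ) ≠ 0 := Nat.cast_ne_zero.2 hc
      push_cast
      field_simp
    · simp [hd]
  · have h1 : n ≠ 1 := by
      rintro rfl
      exact hsm ⟨0, one_dvd _⟩
    have h2 : ¬ n ∣ N := fun hd => hsm ⟨h, hd.trans hN⟩
    rw [if_neg h1, if_neg h2, Finset.sum_eq_zero]
    · simp
    · intro i _
      by_cases hd : b i ∣ n
      · obtain ⟨c, rfl⟩ := hd
        rw [Nat.mul_div_cancel_left _ (Nat.pos_of_ne_zero (hb0 i)), if_neg (c := ∃ j, c ∣ L ^ j),
          mul_zero, ite_self]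
        rintro ⟨j, hj⟩
        refine hsm ⟨j + 1, ?_⟩
        rw [pow_succ']
        exact mul_dvd_mul (hb i) hj
      · rw [if_neg hd]

/-! ### Finiteness of the support and the polynomial contradiction -/

/-- The solution `u` of the linear equation has finite support if the right-hand side has: from a
point `n` of the support the equation at `n * b i₀` leads either into the support of `z` or to
a smaller point of the support with a larger `p`-adic valuation, and the valuations are bounded. -/
theorem finite_support_of_linear_eq {ι : Type*} [Fintype ι] (b e : ι → ℕ) (hb : ∀ i, b i ≠ 0)
    (i₀ : ι) (he : e i₀ ≠ 0) (hmin : ∀ i, i ≠ i₀ → b i₀ < b i) {p : ℕ} [Fact p.Prime]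
    (hval : ∀ i, i ≠ i₀ → padicValNat p (b i) < padicValNat p (b i₀)) (u z : ℕ → ℂ)
    (h : ∀ n, n ≠ 0 → (∑ i, if b i ∣ n then (e i : ℂ) * u (n / b i) else 0) = z n)
    {K : ℕ} (hz : ∀ n, z n ≠ 0 → n ≤ K) :
    ∃ C, ∀ n, n ≠ 0 → u n ≠ 0 → n ≤ C := by
  classical
  set D := ∑ i, b i
  have hbD : ∀ i, b i ≤ D := fun i => Finset.single_le_sum (fun _ _ => Nat.zero_le _)
    (Finset.mem_univ i)
  have hb0 : 0 < b i₀ := Nat.pos_of_ne_zero (hb i₀)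
  have hD1 : 1 ≤ D := hb0.trans_le (hbD i₀)
  have key : ∀ n, n ≠ 0 → u n ≠ 0 → padicValNat p n ≤ K ∧ n ≤ K * D ^ (K - padicValNat p n) := by
    intro n
    induction n using Nat.strong_induction_on with
    | _ n ih =>
      intro hn hu
      by_cases hzn : z (n * b i₀) = 0
      · obtain ⟨i, hi, hd, hui⟩ : ∃ i, i ≠ i₀ ∧ b i ∣ n * b i₀ ∧ u (n * b i₀ / b i) ≠ 0 := by
          by_contra! hcon
          have h1 := h (n * b i₀) (mul_ne_zero hn hb0.ne')
          rw [hzn, Finset.sum_eq_single i₀, if_pos (dvd_mul_left _ _), Nat.mul_div_cancel _ hb0]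
            at h1
          · exact mul_ne_zero (Nat.cast_ne_zero.2 he) hu h1
          · intro i _ hi
            split_ifs with hd
            · rw [hcon i hi hd, mul_zero]
            · rfl
          · simp
        obtain ⟨c, hc⟩ := hd
        have hc0 : c ≠ 0 := by
          rintro rfl
          exact mul_ne_zero hn hb0.ne' hc
        rw [hc, Nat.mul_div_cancel_left _ (Nat.pos_of_ne_zero (hb i))] at hui
        have hcn : c < n := by
          by_contra! hle
          have : n * b i₀ < b i * c := by
            calc n * b i₀ ≤ c * b i₀ := Nat.mul_le_mul_right _ hle
              _ < c * b i := Nat.mul_lt_mul_of_pos_left (hmin i hi) (Nat.pos_of_ne_zero hc0)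
              _ = b i * c := mul_comm _ _
          omega
        obtain ⟨h1, h2⟩ := ih c hcn hc0 hui
        have h3 := congrArg (padicValNat p) hc
        rw [padicValNat.mul hn hb0.ne', padicValNat.mul (hb i) hc0] at h3
        have h4 := hval i hi
        refine ⟨by omega, ?_⟩
        calc n ≤ n * b i₀ := Nat.le_mul_of_pos_right _ hb0
          _ = b i * c := hc
          _ ≤ D * (K * D ^ (K - padicValNat p c)) := Nat.mul_le_mul (hbD i) h2
          _ = K * D ^ (K - padicValNat p c + 1) := by ring
          _ ≤ K * D ^ (K - padicValNat p n) :=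
            Nat.mul_le_mul_left _ (Nat.pow_le_pow_right hD1 (by omega))
      · have h1 : n ≤ K := (Nat.le_mul_of_pos_right _ hb0).trans (hz _ hzn)
        have h2 : padicValNat p n ≤ K :=
          (padicValNat_le_nat_log n).trans ((Nat.log_le_self _ _).trans h1)
        exact ⟨h2, h1.trans (Nat.le_mul_of_pos_right _ (Nat.pow_pos hD1))⟩
  refine ⟨K * D ^ K, fun n hn hu => (key n hn hu).2.trans ?_⟩
  exact Nat.mul_le_mul_left _ (Nat.pow_le_pow_right hD1 (Nat.sub_le _ _))

open Polynomial in
/-- The map `n ↦ X ^ v_p(n)` turns the linear equation into a factorization of polynomials. -/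
theorem exists_polynomial_factorization {ι : Type*} [Fintype ι] (b e : ι → ℕ) (hb : ∀ i, b i ≠ 0)
    {p : ℕ} [Fact p.Prime] (u : ℕ → ℂ) (z : ℕ → ℤ)
    (h : ∀ n, n ≠ 0 → (∑ i, if b i ∣ n then (e i : ℂ) * u (n / b i) else 0) = z n)
    {C : ℕ} (hu : ∀ n, n ≠ 0 → u n ≠ 0 → n ≤ C) {K : ℕ} (hz : ∀ n, K < n → z n = 0) :
    ∃ (Z : ℤ[X]) (U : ℂ[X]), Z.eval 1 = ∑ n ∈ Finset.Icc 1 K, z n ∧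
      Z.map (Int.castRingHom ℂ) =
        (∑ i, Polynomial.C (e i : ℤ) * X ^ padicValNat p (b i) : ℤ[X]).map (Int.castRingHom ℂ) *
          U := by
  classical
  set W := max K (C * ∑ i, b i)
  have hCW : ∀ i, C * b i ≤ W := fun i => le_max_of_le_right (Nat.mul_le_mul_left _
    (Finset.single_le_sum (f := b) (fun _ _ => Nat.zero_le _) (Finset.mem_univ i)))
  refine ⟨∑ n ∈ Finset.Icc 1 W, Polynomial.C (z n) * X ^ padicValNat p n,
    ∑ n ∈ Finset.Icc 1 C, Polynomial.C (u n) * X ^ padicValNat p n, ?_, ?_⟩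
  · simp only [eval_finsetSum, eval_mul, eval_C, eval_pow, eval_X, one_pow, mul_one]
    refine (Finset.sum_subset (Finset.Icc_subset_Icc_right (le_max_left _ _)) ?_).symm
    intro n hn hn'
    simp only [Finset.mem_Icc] at hn hn'
    exact hz n (by omega)
  · have hone : ∀ i, (∑ n ∈ Finset.Icc 1 W, if b i ∣ n then
        Polynomial.C ((e i : ℂ) * u (n / b i)) * X ^ padicValNat p n else 0) =
        ∑ k ∈ Finset.Icc 1 C, (Polynomial.C (e i : ℂ) * X ^ padicValNat p (b i)) *
          (Polynomial.C (u k) * X ^ padicValNat p k) := by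
      intro i
      have hbi := Nat.pos_of_ne_zero (hb i)
      rw [← Finset.sum_filter]
      symm
      refine Finset.sum_of_injOn (fun k => b i * k) ?_ ?_ ?_ ?_
      · intro x _ y _ hxy
        exact Nat.eq_of_mul_eq_mul_left hbi hxy
      · intro k hk
        simp only [Finset.coe_Icc, Set.mem_Icc, Finset.coe_filter, Finset.mem_Icc,
          Set.mem_ofPred_eq] at hk ⊢
        refine ⟨⟨Nat.mul_pos hbi hk.1, ?_⟩, dvd_mul_right _ _⟩
        calc b i * k ≤ b i * C := Nat.mul_le_mul_left _ hk.2
          _ = C * b i := mul_comm _ _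
          _ ≤ W := hCW i
      · intro n hn hn'
        obtain ⟨hn, k, rfl⟩ := Finset.mem_filter.1 hn
        rw [Nat.mul_div_cancel_left _ hbi]
        have hk0 : k ≠ 0 := by
          rintro rfl
          simp at hn
        have : u k = 0 := by
          by_contra hne
          refine hn' ⟨k, ?_, rfl⟩
          simpa using ⟨Nat.pos_of_ne_zero hk0, hu k hk0 hne⟩
        simp [this]
      · intro k hk
        have hk0 : k ≠ 0 := by
          have := (Finset.mem_Icc.1 hk).1
          omega
        rw [Nat.mul_div_cancel_left _ hbi, padicValNat.mul (hb i) hk0, pow_add, C_mul]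
        ring
    simp only [Polynomial.map_sum, Polynomial.map_mul, Polynomial.map_pow, map_C, map_X,
      Int.coe_castRingHom, Int.cast_natCast]
    rw [Finset.sum_mul_sum]
    rw [Finset.sum_congr rfl fun i _ => (hone i).symm]
    rw [Finset.sum_comm]
    refine Finset.sum_congr rfl fun n hn => ?_
    rw [← h n (by have := (Finset.mem_Icc.1 hn).1; omega), map_sum, Finset.sum_mul]
    refine Finset.sum_congr rfl fun i _ => ?_
    split_ifs <;> simp

open Polynomial in
/-- A polynomial over `ℤ` with nonnegative coefficients and at least two terms does not divide, even
over `ℂ`, an integer polynomial with value `1` at `1`: by the Gauss lemma its primitive part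
divides it over `ℤ`, but takes a value `≥ 2` at `1`. -/
theorem not_dvd_of_eval_one_eq_one (B Z : ℤ[X]) (hB : ∀ n, 0 ≤ B.coeff n) {r s : ℕ} (hrs : r ≠ s)
    (hr : B.coeff r ≠ 0) (hs : B.coeff s ≠ 0) (hZ : Z.eval 1 = 1) :
    ¬ B.map (Int.castRingHom ℂ) ∣ Z.map (Int.castRingHom ℂ) := by
  intro hdvd
  have hcomp : (algebraMap ℚ ℂ).comp (Int.castRingHom ℚ) = Int.castRingHom ℂ :=
    RingHom.ext_int _ _
  rw [← hcomp, ← Polynomial.map_map, ← Polynomial.map_map, Polynomial.map_dvd_map'] at hdvd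
  have hB0 : B ≠ 0 := by
    rintro rfl
    simp at hr
  have hcpos : 0 < B.content := lt_of_le_of_ne
    (by rw [← normalize_content]; exact Int.nonneg_of_normalize_eq_self (normalize_idem _))
    (Ne.symm (mt content_eq_zero_iff.1 hB0))
  have hprim : B.primPart.map (Int.castRingHom ℚ) ∣ Z.map (Int.castRingHom ℚ) :=
    (Polynomial.map_dvd _ (primPart_dvd B)).trans hdvd
  rw [← IsPrimitive.Int.dvd_iff_map_cast_dvd_map_cast _ _ B.isPrimitive_primPart] at hprim
  have h1 : B.primPart.eval 1 ∣ 1 := by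
    simpa only [hZ] using eval_dvd (x := 1) hprim
  have hcoef : ∀ n, B.coeff n = B.content * B.primPart.coeff n := by
    intro n
    conv_lhs => rw [B.eq_C_content_mul_primPart]
    rw [coeff_C_mul]
  have hnn : ∀ n, 0 ≤ B.primPart.coeff n := fun n =>
    nonneg_of_mul_nonneg_right (hcoef n ▸ hB n) hcpos
  have hpos : ∀ n, B.coeff n ≠ 0 → 1 ≤ B.primPart.coeff n := by
    intro n hn
    refine lt_of_le_of_ne (hnn n) fun h0 => hn ?_
    rw [hcoef, ← h0, mul_zero]
  have hmem : ∀ n, B.coeff n ≠ 0 → n ∈ B.primPart.support := fun n hn =>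
    mem_support_iff.2 (by have := hpos n hn; omega)
  have h2 : 2 ≤ B.primPart.eval 1 := by
    rw [eval_eq_sum, Polynomial.sum]
    simp only [one_pow, mul_one]
    calc (2 : ℤ) ≤ B.primPart.coeff r + B.primPart.coeff s := by
          have := hpos r hr
          have := hpos s hs
          omega
      _ = ∑ n ∈ {r, s}, B.primPart.coeff n := (Finset.sum_pair hrs).symm
      _ ≤ ∑ n ∈ B.primPart.support, B.primPart.coeff n := by
          refine Finset.sum_le_sum_of_subset_of_nonneg ?_ fun n _ _ => hnn n
          intro n hn
          rcases Finset.mem_insert.1 hn with rfl | hn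
          · exact hmem _ hr
          · rw [Finset.mem_singleton.1 hn]
            exact hmem _ hs
  have := Int.le_of_dvd one_pos h1
  omega

/-! ### Averaging and conclusion -/

/-- Averaging over the dilations `n ↦ n (1 + N j)` with the functional of
`exists_functional_geometric` commutes with the left-hand side of the linear equation, because
`1 + N j` is prime to every `b i`, and removes from the right-hand side all roots except the `N`-th
roots of unity, where `N` is a suitable power of `L`. -/
theorem exists_averaged_solution {ι : Type*} [Fintype ι] (b e : ι → ℕ) {L : ℕ} (hL : L ≠ 0)
    (hb : ∀ i, b i ∣ L) (R : Multiset ℂ) (a : ℕ → ℂ)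
    (ha : ∀ n, n ≠ 0 → (∑ i, if b i ∣ n then (e i * b i : ℂ) * a (n / b i) else 0) =
      1 - (R.map fun ρ => ρ⁻¹ ^ n).sum) :
    ∃ (h : ℕ) (a' : ℕ → ℂ), ∀ n, (∃ j, n ∣ L ^ j) →
      (∑ i, if b i ∣ n then (e i * b i : ℂ) * a' (n / b i) else 0) =
        1 - ((R.filter fun ρ => ρ ^ L ^ h = 1).map fun ρ => ρ⁻¹ ^ n).sum := by
  classical
  have hb0 : ∀ i, b i ≠ 0 := fun i => ne_zero_of_dvd_ne_zero hL (hb i)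
  obtain ⟨h, hh0, hh⟩ : ∃ h, h ≠ 0 ∧ ∀ ρ ∈ R, (∃ j, ρ ^ L ^ j = 1) → ρ ^ L ^ h = 1 := by
    have : ∀ ρ : ℂ, ∃ j, (∃ j, ρ ^ L ^ j = 1) → ρ ^ L ^ j = 1 := by
      intro ρ
      by_cases hρ : ∃ j, ρ ^ L ^ j = 1
      · exact ⟨hρ.choose, fun _ => hρ.choose_spec⟩
      · exact ⟨0, fun h => absurd h hρ⟩
    choose o ho using this
    refine ⟨∑ ρ ∈ R.toFinset, o ρ + 1, by omega, fun ρ hρ hj => ?_⟩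
    have hle : o ρ ≤ ∑ ρ ∈ R.toFinset, o ρ + 1 :=
      (Finset.single_le_sum (f := o) (fun _ _ => Nat.zero_le _) (Multiset.mem_toFinset.2 hρ)).trans
        (Nat.le_succ _)
    obtain ⟨c, hc⟩ := pow_dvd_pow L hle
    rw [hc, pow_mul, ho ρ hj, one_pow]
  set N := L ^ h with hN
  have hbN : ∀ i, b i ∣ N := fun i => (hb i).trans (dvd_pow_self L hh0)
  obtain ⟨Λ, hΛ⟩ := exists_functional_geometric
  refine ⟨h, fun n => Λ fun j => a (n * (1 + N * j)), fun n hn => ?_⟩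
  have hn0 : n ≠ 0 := by
    obtain ⟨j, hj⟩ := hn
    exact ne_zero_of_dvd_ne_zero (pow_ne_zero j hL) hj
  have hleft : (∑ i, if b i ∣ n then
      (e i * b i : ℂ) * Λ (fun j => a (n / b i * (1 + N * j))) else 0) =
      Λ fun j => ∑ i, if b i ∣ n * (1 + N * j) then
        (e i * b i : ℂ) * a (n * (1 + N * j) / b i) else 0 := by
    have : (fun j => ∑ i, if b i ∣ n * (1 + N * j) then
        (e i * b i : ℂ) * a (n * (1 + N * j) / b i) else 0) =
        ∑ i, if b i ∣ n then (e i * b i : ℂ) • (fun j => a (n / b i * (1 + N * j))) else 0 := by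
      funext j
      rw [Finset.sum_apply]
      refine Finset.sum_congr rfl fun i _ => ?_
      have hcop : (b i).Coprime (1 + N * j) := by
        obtain ⟨c, hc⟩ := hbN i
        rw [hc, mul_assoc]
        simp
      by_cases hd : b i ∣ n
      · rw [if_pos hd, if_pos (hcop.dvd_mul_right.2 hd)]
        simp only [Pi.smul_apply, smul_eq_mul]
        rw [Nat.div_mul_right_comm hd]
      · simp [hd, hcop.dvd_mul_right]
    rw [this, map_sum]
    refine Finset.sum_congr rfl fun i _ => ?_
    split_ifs
    · rw [map_smul, smul_eq_mul]
    · simp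
  have hgeom : ∀ ρ : ℂ, (fun j => ρ⁻¹ ^ (n * (1 + N * j))) =
      ρ⁻¹ ^ n • fun j => (ρ⁻¹ ^ (n * N)) ^ j := by
    intro ρ
    funext j
    rw [Pi.smul_apply, smul_eq_mul, ← pow_mul, ← pow_add]
    ring_nf
  have hright : ∀ S : Multiset ℂ, (∀ ρ ∈ S, ρ ∈ R) →
      Λ (fun j => (S.map fun ρ => ρ⁻¹ ^ (n * (1 + N * j))).sum) =
        ((S.filter fun ρ => ρ ^ N = 1).map fun ρ => ρ⁻¹ ^ n).sum := by
    intro S hS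
    induction S using Multiset.induction_on with
    | empty =>
      simp only [Multiset.map_zero, Multiset.sum_zero, Multiset.filter_zero]
      exact map_zero Λ
    | cons ρ S ih =>
      have hsplit : (fun j => ((ρ ::ₘ S).map fun ρ => ρ⁻¹ ^ (n * (1 + N * j))).sum) =
          (fun j => ρ⁻¹ ^ (n * (1 + N * j))) +
            fun j => (S.map fun ρ => ρ⁻¹ ^ (n * (1 + N * j))).sum := by
        funext j
        simp
      rw [hsplit, map_add, ih fun σ hσ => hS σ (Multiset.mem_cons_of_mem hσ), hgeom, map_smul, hΛ]
      -- for `n` composed of primes of `L`, only `N`-th roots of unity satisfy `ρ ^ (n * N) = 1`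
      have hiff : ρ⁻¹ ^ (n * N) = 1 ↔ ρ ^ N = 1 := by
        rw [inv_pow, inv_eq_one]
        constructor
        · intro hρ
          refine hh ρ (hS ρ (Multiset.mem_cons_self ρ S)) ?_
          obtain ⟨j, c, hc⟩ := hn
          refine ⟨j + h, ?_⟩
          rw [pow_add, hc, ← hN, show n * c * N = n * N * c by ring, pow_mul, hρ, one_pow]
        · intro hρ
          rw [mul_comm, pow_mul, hρ, one_pow]
      by_cases hρ : ρ ^ N = 1
      · rw [if_pos (hiff.2 hρ), Multiset.filter_cons_of_pos (p := fun ρ => ρ ^ N = 1) _ hρ]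
        simp
      · rw [if_neg (mt hiff.1 hρ), Multiset.filter_cons_of_neg (p := fun ρ => ρ ^ N = 1) _ hρ]
        simp
  rw [hleft]
  have hfun : (fun j => ∑ i, if b i ∣ n * (1 + N * j) then
        (e i * b i : ℂ) * a (n * (1 + N * j) / b i) else 0) =
      (fun j => (1 : ℂ) ^ j) - fun j => (R.map fun ρ => ρ⁻¹ ^ (n * (1 + N * j))).sum := by
    funext j
    rw [ha _ (mul_ne_zero hn0 (by omega))]
    simp
  rw [hfun, map_sub, hΛ, if_pos rfl, hright R fun _ => id]

theorem theorem2 (m : ℕ) (hm : 1 ≤ m) (b e : Fin (m + 1) → ℕ)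
    (hb_pos : ∀ i, 0 < b i) (hb_mono : StrictMono b) (he_pos : ∀ i, 0 < e i)
    (hpt : ∃ p t : ℕ, p.Prime ∧ 0 < t ∧ p ^ t ∣ b 0 ∧ ∀ i, i ≠ 0 → ¬ p ^ t ∣ b i)
    (P : Polynomial ℤ) (hP0 : P.eval 0 = 1) (hP1 : P.eval 1 ≠ 0) :
    ¬ ∃ f : PowerSeries ℂ,
      ∏ i, (PowerSeries.expand (b i) (hb_pos i).ne' f) ^ e i =
        ((P.map (Int.castRingHom ℂ) : Polynomial ℂ) : PowerSeries ℂ) *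
          (1 - PowerSeries.X : PowerSeries ℂ)⁻¹ := by
  classical
  rintro ⟨f, hf⟩
  obtain ⟨p, t, hp, -, hp0, hpi⟩ := hpt
  have : Fact p.Prime := ⟨hp⟩
  have hb0 : ∀ i, b i ≠ 0 := fun i => (hb_pos i).ne'
  have hval : ∀ i, i ≠ 0 → padicValNat p (b i) < padicValNat p (b 0) := by
    intro i hi
    have h1 := (padicValNat_dvd_iff_le (hb0 0)).1 hp0
    have h2 := mt (padicValNat_dvd_iff_le (hb0 i)).2 (hpi i hi)
    omega
  have hPC0 : (P.map (Int.castRingHom ℂ)).eval 0 = 1 := by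
    have := Polynomial.eval_map_apply (Int.castRingHom ℂ) (0 : ℤ) (p := P)
    rw [map_zero, hP0, map_one] at this
    exact this
  have hPC1 : (P.map (Int.castRingHom ℂ)).rootMultiplicity 1 = 0 := by
    refine Polynomial.rootMultiplicity_eq_zero fun h => hP1 ?_
    have := Polynomial.eval_map_apply (Int.castRingHom ℂ) (1 : ℤ) (p := P)
    rw [map_one, h] at this
    simpa using this.symm
  have hPne : P ≠ 0 := by
    rintro rfl
    simp at hP1
  set L := ∏ i, b i
  have hL : L ≠ 0 := Finset.prod_ne_zero_iff.2 fun i _ => hb0 i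
  have hbL : ∀ i, b i ∣ L := fun i => Finset.dvd_prod_of_mem b (Finset.mem_univ i)
  obtain ⟨a, ha⟩ := exists_logDeriv_coeff b e hb0 ⟨0, (he_pos 0).ne'⟩ _ hPC0 f hf
  obtain ⟨h, a', ha'⟩ := exists_averaged_solution b e hL hbL _ a ha
  have hN : L ^ h ≠ 0 := pow_ne_zero h hL
  obtain ⟨k, hk, hksum⟩ := IsRootSum.roots hN P hPne
  simp only [hk] at ha'
  obtain ⟨u, hu⟩ := exists_moebius_transform b e hL hbL dvd_rfl k a' ha'
  set z : ℕ → ℤ := fun n => (if n = 1 then 1 else 0) - if n ∣ L ^ h then k n else 0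
  have hz : ∀ n, L ^ h < n → z n = 0 := by
    intro n hn
    have h1 : n ≠ 1 := by
      have := Nat.pos_of_ne_zero hN
      omega
    have h2 : ¬ n ∣ L ^ h := fun hd => absurd (Nat.le_of_dvd (Nat.pos_of_ne_zero hN) hd) (by omega)
    simp [z, h1, h2]
  have hzsum : ∑ n ∈ Finset.Icc 1 (L ^ h), z n = 1 := by
    rw [Finset.sum_sub_distrib, Finset.sum_ite_eq',
      if_pos (Finset.mem_Icc.2 ⟨le_rfl, Nat.pos_of_ne_zero hN⟩), ← Finset.sum_filter]
    have : (Finset.Icc 1 (L ^ h)).filter (· ∣ L ^ h) = (L ^ h).divisors := by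
      ext n
      simp only [Finset.mem_filter, Finset.mem_Icc, Nat.mem_divisors]
      constructor
      · exact fun hn => ⟨hn.2, hN⟩
      · exact fun hn => ⟨⟨Nat.pos_of_dvd_of_pos hn.1 (Nat.pos_of_ne_zero hN),
          Nat.le_of_dvd (Nat.pos_of_ne_zero hN) hn.1⟩, hn.1⟩
    rw [this, hksum, hPC1]
    simp
  obtain ⟨C, hC⟩ := finite_support_of_linear_eq b e hb0 0 (he_pos 0).ne'
    (fun i hi => hb_mono (Fin.pos_iff_ne_zero.2 hi)) hval u (fun n => (z n : ℂ)) hu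
    (K := L ^ h) (fun n hn => by
      by_contra! hlt
      exact hn (by rw [hz n hlt, Int.cast_zero]))
  obtain ⟨Z, U, hZ1, hZU⟩ := exists_polynomial_factorization b e hb0 (p := p) u z hu hC hz
  have hcoeff : ∀ n, (∑ i, Polynomial.C (e i : ℤ) * Polynomial.X ^ padicValNat p (b i)).coeff n =
      ∑ i, if n = padicValNat p (b i) then (e i : ℤ) else 0 := by
    intro n
    simp only [Polynomial.finsetSum_coeff, Polynomial.coeff_C_mul_X_pow]
  have hnn : ∀ n i, (0 : ℤ) ≤ if n = padicValNat p (b i) then (e i : ℤ) else 0 := by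
    intro n i
    split_ifs <;> omega
  have hne : ∀ i, (∑ i, Polynomial.C (e i : ℤ) * Polynomial.X ^ padicValNat p (b i)).coeff
      (padicValNat p (b i)) ≠ 0 := by
    intro i
    rw [hcoeff]
    refine (Finset.sum_pos' (fun j _ => hnn _ j) ⟨i, Finset.mem_univ i, ?_⟩).ne'
    rw [if_pos rfl]
    exact_mod_cast he_pos i
  have h10 : Fin.last m ≠ 0 := Fin.ne_of_gt (Fin.mk_lt_mk.2 hm)
  exact not_dvd_of_eval_one_eq_one _ Z
    (fun n => by rw [hcoeff]; exact Finset.sum_nonneg fun i _ => hnn n i)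
    (hval _ h10).ne (hne (Fin.last m)) (hne 0) (hZ1.trans hzsum) ⟨U, hZU⟩
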